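/- \textbf{Conventions.} A \emph{quantaloid} is a category $\mathcal Q$ whose hom-sets are complete lattices and whose composition preserves arbitrary suprema in each variable; it is \emph{small} if its objects and its morphisms form sets. A \emph{homomorphism} of quantaloids is a functor preserving suprema of parallel morphisms, and an \emph{equivalence} of quantaloids is a homomorphism that is an equivalence of categories. An \emph{involution} on $\mathcal Q$ is a homomorphism $(-)^{\mathrm o}\colon\mathcal Q^{\mathrm{op}}\to\mathcal Q$ that is the identity on objects and satisfies $f^{\mathrm{oo}}=f$. A morphism $f\colon X\to Y$ is \emph{left adjoint} to $f^*\colon Y\to X$ if $1_X\le f^*f$ and $ff^*\le 1_Y$. For a small site $(\mathcal C,J)$, a \emph{closed crible} from $X$ to $Y$ is a set $R$ of spans $X\xleftarrow{f}Z\xrightarrow{g}Y$ in $\mathcal C$ such that (i) $(f,g)\in R$ implies $(fh,gh)\in R$ for every $h\colon W\to Z$, and (ii) if $S\in J(Z)$ and $(fs,gs)\in R$ for all $s\in S$, then $(f,g)\in R$. Let $\mathcal R(\mathcal C,J)$ be the quantaloid whose objects are those of $\mathcal C$, whose morphisms $X\to Y$ are the closed cribles from $X$ to $Y$ ordered by inclusion,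 in which the composite of $R\colon X\to Y$ and $S\colon Y\to Z$ is the smallest closed crible containing all $(f,g)$ such that $(f,h)\in R$ and $(h,g)\in S$ for some $h$, and in which the identity on $X$ is the smallest closed crible containing all $(f,f)$. A \emph{small quantaloid of closed cribles} is a small quantaloid that is equivalent to $\mathcal R(\mathcal C,J)$ for some small site $(\mathcal C,J)$. For a quantaloid $\mathcal Q$ with involution, a \emph{symmetric $\mathcal Q$-category} $\mathbb A$ is a set $\mathbb A_0$ with, for each $x\in\mathbb A_0$, an object $tx$ of $\mathcal Q$ and, for all $x,y\in\mathbb A_0$, a morphism $\mathbb A(y,x)\colon tx\to ty$, such that $\mathbb A(z,y)\,\mathbb A(y,x)\le\mathbb A(z,x)$, $1_{tx}\le\mathbb A(x,x)$ and $\mathbb A(x,y)=\mathbb A(y,x)^{\mathrm o}$ for all $x,y,z$. A \emph{distributor} $\Phi\colon\mathbb A\to\mathbb B$ is a family of morphisms $\Phi(y,x)\colon tx\to ty$ ($x\in\mathbb A_0$, $y\in\mathbb B_0$) with $\mathbb B(y',y)\,\Phi(y,x)\le\Phi(y',x)$ and $\Phi(y,x)\,\mathbb A(x,x')\le\Phi(y,x')$.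 Symmetric $\mathcal Q$-categories and distributors form a quantaloid $\mathsf{SymDist}(\mathcal Q)$ with the elementwise order, composition $(\Psi\otimes\Phi)(z,x)=\bigvee_y\Psi(z,y)\,\Phi(y,x)$, identities given by the hom-arrows, and involution $\Phi^{\mathrm o}(x,y)=\Phi(y,x)^{\mathrm o}$. \textbf{Theorem.} Let $\mathcal Q$ be a small quantaloid of closed cribles. Then $$q\;\longmapsto\; q^{\mathrm o}:=\bigvee\{\,gf^*\mid f\colon U\to X,\ g\colon U\to Y\text{ left adjoints with } fg^*\le q\,\}\qquad(q\colon Y\to X)$$ is an involution on $\mathcal Q$, and the quantaloid $\mathsf{SymDist}(\mathcal Q)$ formed with respect to it has the following properties. \begin{enumerate} \item It is \emph{modular}: $gf\wedge h\le g(f\wedge g^{\mathrm o}h)$ for all $f\colon X\to Y$, $g\colon Y\to Z$, $h\colon X\to Z$. \item It is \emph{tabular}: for every $q\colon X\to Y$ there are left adjoints $f\colon U\to Y$ and $g\colon U\to X$ with $fg^{\mathrm o}=q$ and $f^{\mathrm o}f\wedge g^{\mathrm o}g=1_U$. \item All symmetric idempotents split symmetrically: for every $e\colon A\to A$ with $ee=e=e^{\mathrm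 o}$ there are an object $B$ and morphisms $p\colon A\to B$, $q\colon B\to A$ with $qp=e$, $pq=1_B$ and $q=p^{\mathrm o}$. \end{enumerate} -/

import Mathlib

open CategoryTheory

universe v u

/-- A quantaloid: a category whose hom-sets are complete lattices and whose composition preserves
arbitrary suprema in each variable. -/
class Quantaloid (Q : Type u) extends Category.{v} Q where
  [homLattice : ∀ X Y : Q, CompleteLattice (X ⟶ Y)]
  sSup_comp : ∀ {X Y Z : Q} (S : Set (X ⟶ Y)) (g : Y ⟶ Z), sSup S ≫ g = ⨆ f ∈ S, f ≫ g
  comp_sSup : ∀ {X Y Z : Q} (f : X ⟶ Y) (S : Set (Y ⟶ Z)), f ≫ sSup S = ⨆ g ∈ S, f ≫ g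

attribute [reducible, instance] Quantaloid.homLattice

namespace Quantaloid

section Basic

variable {Q : Type u} [Quantaloid.{v} Q]

theorem iSup_comp {ι : Sort*} {X Y Z : Q} (f : ι → (X ⟶ Y)) (g : Y ⟶ Z) :
    (⨆ i, f i) ≫ g = ⨆ i, f i ≫ g := by
  rw [iSup, sSup_comp, iSup_range]

theorem comp_iSup {ι : Sort*} {X Y Z : Q} (f : X ⟶ Y) (g : ι → (Y ⟶ Z)) :
    f ≫ (⨆ i, g i) = ⨆ i, f ≫ g i := by
  rw [iSup, comp_sSup, iSup_range]

theorem comp_mono {X Y Z : Q} {f f' : X ⟶ Y} {g g' : Y ⟶ Z} (hf : f ≤ f') (hg : g ≤ g') :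
    f ≫ g ≤ f' ≫ g' := by
  have h1 : f ≫ g ≤ f' ≫ g := by
    have h := sSup_comp {f, f'} g
    rw [sSup_pair, sup_eq_right.2 hf, iSup_pair] at h
    rw [h]; exact le_sup_left
  have h2 : f' ≫ g ≤ f' ≫ g' := by
    have h := comp_sSup f' {g, g'}
    rw [sSup_pair, sup_eq_right.2 hg, iSup_pair] at h
    rw [h]; exact le_sup_left
  exact h1.trans h2

/-- `f ⊣ g` in the locally ordered 2-category underlying a quantaloid. -/
def IsAdjoint {X Y : Q} (f : X ⟶ Y) (g : Y ⟶ X) : Prop :=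
  𝟙 X ≤ f ≫ g ∧ g ≫ f ≤ 𝟙 Y

/-- `f` is a left adjoint. -/
def IsLeftAdj {X Y : Q} (f : X ⟶ Y) : Prop :=
  ∃ g : Y ⟶ X, IsAdjoint f g

end Basic

/-- A homomorphism of quantaloids: a functor that preserves suprema of parallel morphisms. -/
def IsHomomorphism {Q R : Type*} [Quantaloid Q] [Quantaloid R] (F : Q ⥤ R) : Prop :=
  ∀ {X Y : Q} (S : Set (X ⟶ Y)), F.map (sSup S) = ⨆ f ∈ S, F.map f

/-- `Q` and `R` are equivalent quantaloids. -/
def Equivalent (Q R : Type*) [Quantaloid Q] [Quantaloid R] : Prop :=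
  ∃ F : Q ⥤ R, IsHomomorphism F ∧ F.IsEquivalence

/-- An involution on a quantaloid: a homomorphism `Qᵒᵖ ⥤ Q` that is the identity on objects and
its own inverse. -/
structure Involution (Q : Type u) [Quantaloid.{v} Q] where
  inv : ∀ {X Y : Q}, (X ⟶ Y) → (Y ⟶ X)
  inv_inv : ∀ {X Y : Q} (f : X ⟶ Y), inv (inv f) = f
  inv_id : ∀ X : Q, inv (𝟙 X) = 𝟙 X
  inv_comp : ∀ {X Y Z : Q} (f : X ⟶ Y) (g : Y ⟶ Z), inv (f ≫ g) = inv g ≫ inv f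
  inv_sSup : ∀ {X Y : Q} (S : Set (X ⟶ Y)), inv (sSup S) = ⨆ f ∈ S, inv f

section Properties

variable {Q : Type u} [Quantaloid.{v} Q]

theorem Involution.inv_iSup (I : Involution Q) {ι : Sort*} {X Y : Q} (f : ι → (X ⟶ Y)) :
    I.inv (⨆ i, f i) = ⨆ i, I.inv (f i) := by
  rw [iSup, I.inv_sSup, iSup_range]

theorem Involution.inv_mono (I : Involution Q) {X Y : Q} {f g : X ⟶ Y} (h : f ≤ g) :
    I.inv f ≤ I.inv g := by
  have h' := I.inv_sSup {f, g}
  rw [sSup_pair, sup_eq_right.2 h, iSup_pair] at h'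
  rw [h']; exact le_sup_left

/-- The modular law `g f ∧ h ≤ g (f ∧ gᵒ h)`. -/
def IsModular (I : Involution Q) : Prop :=
  ∀ {X Y Z : Q} (f : X ⟶ Y) (g : Y ⟶ Z) (h : X ⟶ Z),
    f ≫ g ⊓ h ≤ (f ⊓ h ≫ I.inv g) ≫ g

/-- Every `q : X ⟶ Y` is `f gᵒ` for a span of left adjoints with `fᵒ f ∧ gᵒ g = 1`. -/
def IsTabular (I : Involution Q) : Prop :=
  ∀ {X Y : Q} (q : X ⟶ Y), ∃ (U : Q) (f : U ⟶ Y) (g : U ⟶ X),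
    IsLeftAdj f ∧ IsLeftAdj g ∧ I.inv g ≫ f = q ∧ f ≫ I.inv f ⊓ g ≫ I.inv g = 𝟙 U

/-- Every symmetric idempotent `e` has a splitting `e = q p`, `p q = 1` with `q = pᵒ`. -/
def SymmetricIdempotentsSplitSymmetrically (I : Involution Q) : Prop :=
  ∀ {A : Q} (e : A ⟶ A), e ≫ e = e → I.inv e = e →
    ∃ (B : Q) (p : A ⟶ B) (q : B ⟶ A), p ≫ q = e ∧ q ≫ p = 𝟙 B ∧ q = I.inv p

/-- For `q : Y ⟶ X`, the supremum of all `g f*`, over the spans `(f, g)` of left adjoints with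
`f g* ≤ q`. -/
def canonicalInvolute {X Y : Q} (q : Y ⟶ X) : X ⟶ Y :=
  sSup {r | ∃ (U : Q) (f : U ⟶ X) (f' : X ⟶ U) (g : U ⟶ Y) (g' : Y ⟶ U),
    IsAdjoint f f' ∧ IsAdjoint g g' ∧ g' ≫ f ≤ q ∧ r = f' ≫ g}

end Properties

/-! ### Enriched categories and distributors -/

/-- A category enriched in the quantaloid `Q`, with a set of objects in the universe `u`;
`hom x y` is the hom-arrow usually written `𝔸(y, x) : tx ⟶ ty`. -/
structure QCat (Q : Type u) [Quantaloid.{u} Q] where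
  Obj : Type u
  type : Obj → Q
  hom : ∀ x y : Obj, type x ⟶ type y
  hom_comp : ∀ x y z, hom x y ≫ hom y z ≤ hom x z
  id_le : ∀ x, 𝟙 (type x) ≤ hom x x

/-- `𝔸` is symmetric: `𝔸(x, y) = 𝔸(y, x)ᵒ`. -/
def QCat.IsSymmetric {Q : Type u} [Quantaloid.{u} Q] (I : Involution Q) (A : QCat Q) : Prop :=
  ∀ x y : A.Obj, A.hom y x = I.inv (A.hom x y)

/-- A distributor `𝔸 ⇸ 𝔹`; `app x y` is the element usually written `Φ(y, x) : tx ⟶ ty`. -/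
@[ext]
structure Distributor {Q : Type u} [Quantaloid.{u} Q] (A B : QCat Q) where
  app : ∀ (x : A.Obj) (y : B.Obj), A.type x ⟶ B.type y
  app_hom : ∀ x y y', app x y ≫ B.hom y y' ≤ app x y'
  hom_app : ∀ x' x y, A.hom x' x ≫ app x y ≤ app x' y

namespace Distributor

variable {Q : Type u} [Quantaloid.{u} Q] {A B C D : QCat Q}

instance : LE (Distributor A B) := ⟨fun Φ Ψ => ∀ x y, Φ.app x y ≤ Ψ.app x y⟩

instance : PartialOrder (Distributor A B) where
  le_refl _ _ _ := le_rfl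
  le_trans _ _ _ h h' x y := (h x y).trans (h' x y)
  le_antisymm _ _ h h' := Distributor.ext (funext fun x => funext fun y => (h x y).antisymm (h' x y))

/-- Elementwise supremum. -/
def sup (S : Set (Distributor A B)) : Distributor A B where
  app x y := ⨆ Φ ∈ S, Φ.app x y
  app_hom x y y' := by
    simp only [iSup_comp]
    exact iSup₂_mono fun Φ _ => Φ.app_hom x y y'
  hom_app x' x y := by
    simp only [comp_iSup]
    exact iSup₂_mono fun Φ _ => Φ.hom_app x' x y

/-- Elementwise infimum. -/
def inf (S : Set (Distributor A B)) : Distributor A B where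
  app x y := ⨅ Φ ∈ S, Φ.app x y
  app_hom x y y' := le_iInf₂ fun Φ h =>
    (comp_mono (iInf₂_le Φ h) le_rfl).trans (Φ.app_hom x y y')
  hom_app x' x y := le_iInf₂ fun Φ h =>
    (comp_mono le_rfl (iInf₂_le Φ h)).trans (Φ.hom_app x' x y)

instance : CompleteLattice (Distributor A B) where
  sup Φ Ψ :=
    { app := fun x y => Φ.app x y ⊔ Ψ.app x y
      app_hom := fun x y y' => by
        rw [sup_eq_iSup, iSup_comp]
        refine iSup_le fun b => ?_
        cases b
        · exact (Ψ.app_hom x y y').trans le_sup_right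
        · exact (Φ.app_hom x y y').trans le_sup_left
      hom_app := fun x' x y => by
        rw [sup_eq_iSup, comp_iSup]
        refine iSup_le fun b => ?_
        cases b
        · exact (Ψ.hom_app x' x y).trans le_sup_right
        · exact (Φ.hom_app x' x y).trans le_sup_left }
  le_sup_left _ _ _ _ := le_sup_left
  le_sup_right _ _ _ _ := le_sup_right
  sup_le _ _ _ h h' x y := sup_le (h x y) (h' x y)
  inf Φ Ψ :=
    { app := fun x y => Φ.app x y ⊓ Ψ.app x y
      app_hom := fun x y y' => le_inf
        ((comp_mono inf_le_left le_rfl).trans (Φ.app_hom x y y'))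
        ((comp_mono inf_le_right le_rfl).trans (Ψ.app_hom x y y'))
      hom_app := fun x' x y => le_inf
        ((comp_mono le_rfl inf_le_left).trans (Φ.hom_app x' x y))
        ((comp_mono le_rfl inf_le_right).trans (Ψ.hom_app x' x y)) }
  inf_le_left _ _ _ _ := inf_le_left
  inf_le_right _ _ _ _ := inf_le_right
  le_inf _ _ _ h h' x y := le_inf (h x y) (h' x y)
  sSup := sup
  isLUB_sSup S := ⟨fun Φ h _ _ => le_iSup₂_of_le Φ h le_rfl,
    fun _ h x y => iSup₂_le fun _ h' => h h' x y⟩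
  sInf := inf
  isGLB_sInf S := ⟨fun Φ h _ _ => iInf₂_le_of_le Φ h le_rfl,
    fun _ h x y => le_iInf₂ fun _ h' => h h' x y⟩
  top := ⟨fun _ _ => ⊤, fun _ _ _ => le_top, fun _ _ _ => le_top⟩
  le_top _ _ _ := le_top
  bot := ⟨fun _ _ => ⊥,
    fun x y y' => by
      have h := sSup_comp (∅ : Set (A.type x ⟶ B.type y)) (B.hom y y')
      simp only [sSup_empty, Set.mem_empty_iff_false, iSup_false, iSup_bot] at h
      exact h.le,
    fun x' x y => by
      have h := comp_sSup (A.hom x' x) (∅ : Set (A.type x ⟶ B.type y))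
      simp only [sSup_empty, Set.mem_empty_iff_false, iSup_false, iSup_bot] at h
      exact h.le⟩
  bot_le _ _ _ := bot_le

/-- The identity distributor on `𝔸`, whose elements are the hom-arrows. -/
def id (A : QCat Q) : Distributor A A :=
  ⟨A.hom, A.hom_comp, A.hom_comp⟩

/-- The composite `Ψ ⊗ Φ`, with elements `(Ψ ⊗ Φ)(z, x) = ⋁ y, Ψ(z, y) ∘ Φ(y, x)`. -/
def comp (Φ : Distributor A B) (Ψ : Distributor B C) : Distributor A C where
  app x z := ⨆ y, Φ.app x y ≫ Ψ.app y z
  app_hom x z z' := by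
    rw [iSup_comp]
    refine iSup_mono fun y => ?_
    rw [Category.assoc]
    exact comp_mono le_rfl (Ψ.app_hom y z z')
  hom_app x' x z := by
    rw [comp_iSup]
    refine iSup_mono fun y => ?_
    rw [← Category.assoc]
    exact comp_mono (Φ.hom_app x' x y) le_rfl

theorem id_comp (Φ : Distributor A B) : (id A).comp Φ = Φ := by
  ext x y
  refine le_antisymm (iSup_le fun x' => Φ.hom_app x x' y) ?_
  refine le_iSup_of_le x ?_
  calc Φ.app x y = 𝟙 _ ≫ Φ.app x y := (Category.id_comp _).symm
    _ ≤ _ := comp_mono (A.id_le x) le_rfl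

theorem comp_id (Φ : Distributor A B) : Φ.comp (id B) = Φ := by
  ext x y
  refine le_antisymm (iSup_le fun y' => Φ.app_hom x y' y) ?_
  refine le_iSup_of_le y ?_
  calc Φ.app x y = Φ.app x y ≫ 𝟙 _ := (Category.comp_id _).symm
    _ ≤ _ := comp_mono le_rfl (B.id_le y)

theorem comp_assoc (Φ : Distributor A B) (Ψ : Distributor B C) (Θ : Distributor C D) :
    (Φ.comp Ψ).comp Θ = Φ.comp (Ψ.comp Θ) := by
  ext x w
  simp only [comp, iSup_comp, comp_iSup, Category.assoc]
  exact iSup_comm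

theorem iSup_app {ι : Sort*} (Φ : ι → Distributor A B) (x : A.Obj) (y : B.Obj) :
    (⨆ i, Φ i).app x y = ⨆ i, (Φ i).app x y :=
  (iSup_range (g := fun Ψ : Distributor A B => Ψ.app x y) (f := Φ))

theorem sup_comp (S : Set (Distributor A B)) (Ψ : Distributor B C) :
    (sSup S).comp Ψ = ⨆ Φ ∈ S, Φ.comp Ψ := by
  ext x z
  simp only [iSup_app]
  change (⨆ y, (⨆ Φ ∈ S, Φ.app x y) ≫ Ψ.app y z) = ⨆ Φ ∈ S, ⨆ y, Φ.app x y ≫ Ψ.app y z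
  simp only [iSup_comp]
  rw [iSup_comm]
  exact iSup_congr fun Φ => iSup_comm

theorem comp_sup (Φ : Distributor A B) (S : Set (Distributor B C)) :
    Φ.comp (sSup S) = ⨆ Ψ ∈ S, Φ.comp Ψ := by
  ext x z
  simp only [iSup_app]
  change (⨆ y, Φ.app x y ≫ (⨆ Ψ ∈ S, Ψ.app y z)) = ⨆ Ψ ∈ S, ⨆ y, Φ.app x y ≫ Ψ.app y z
  simp only [comp_iSup]
  rw [iSup_comm]
  exact iSup_congr fun Ψ => iSup_comm

end Distributor

/-- The quantaloid `Dist(Q)` of `Q`-categories and distributors. -/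
instance (Q : Type u) [Quantaloid.{u} Q] : Quantaloid.{u} (QCat Q) where
  Hom A B := Distributor A B
  id A := Distributor.id A
  comp Φ Ψ := Distributor.comp Φ Ψ
  id_comp := Distributor.id_comp
  comp_id := Distributor.comp_id
  assoc := Distributor.comp_assoc
  homLattice _ _ := inferInstanceAs (CompleteLattice (Distributor _ _))
  sSup_comp := Distributor.sup_comp
  comp_sSup := Distributor.comp_sup

/-- The objects of `SymDist(Q)`: symmetric `Q`-categories. -/
structure SymDist {Q : Type u} [Quantaloid.{u} Q] (I : Involution Q) where
  cat : QCat Q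
  symm : cat.IsSymmetric I

/-- `SymDist(Q)` is a full subquantaloid of `Dist(Q)`. -/
instance {Q : Type u} [Quantaloid.{u} Q] (I : Involution Q) : Quantaloid.{u} (SymDist I) where
  Hom A B := Distributor A.cat B.cat
  id A := Distributor.id A.cat
  comp Φ Ψ := Distributor.comp Φ Ψ
  id_comp := Distributor.id_comp
  comp_id := Distributor.comp_id
  assoc := Distributor.comp_assoc
  homLattice _ _ := inferInstanceAs (CompleteLattice (Distributor _ _))
  sSup_comp := Distributor.sup_comp
  comp_sSup := Distributor.comp_sup

/-- The involute of a distributor between symmetric `Q`-categories: `Φᵒ(a, b) = Φ(b, a)ᵒ`. -/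
def Distributor.involute {Q : Type u} [Quantaloid.{u} Q] (I : Involution Q) {A B : QCat Q}
    (hA : A.IsSymmetric I) (hB : B.IsSymmetric I) (Φ : Distributor A B) : Distributor B A where
  app y x := I.inv (Φ.app x y)
  app_hom y x x' := by
    rw [hA x' x, ← I.inv_comp]
    exact I.inv_mono (Φ.hom_app x' x y)
  hom_app y' y x := by
    rw [hB y y', ← I.inv_comp]
    exact I.inv_mono (Φ.app_hom x y y')

/-- The involution of `SymDist(Q)`. -/
def SymDist.involution {Q : Type u} [Quantaloid.{u} Q] (I : Involution Q) :
    Involution (SymDist I) where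
  inv {A B} Φ := Distributor.involute I A.symm B.symm Φ
  inv_inv Φ := Distributor.ext (funext fun _ => funext fun _ => I.inv_inv _)
  inv_id A := Distributor.ext (funext fun x => funext fun y => (A.symm y x).symm)
  inv_comp Φ Ψ := Distributor.ext (funext fun z => funext fun x =>
    (I.inv_iSup _).trans (iSup_congr fun _ => I.inv_comp _ _))
  inv_sSup {A B} S := by
    refine Distributor.ext (funext fun y => funext fun x => ?_)
    change I.inv (⨆ Φ ∈ S, Distributor.app Φ x y) =
      (⨆ Φ ∈ S, (Distributor.involute I A.symm B.symm Φ)).app y x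
    simp only [I.inv_iSup, Distributor.iSup_app]
    rfl

end Quantaloid

/-! ### Closed cribles in a site -/

/-- A closed crible from `X` to `Y`: a set of spans `X ← Z → Y` that is closed under
precomposition and contains each span that belongs to it locally on a covering sieve. -/
@[ext]
structure ClosedCrible {C : Type u} [Category.{v} C] (J : GrothendieckTopology C) (X Y : C) where
  mem : ∀ {Z : C}, (Z ⟶ X) → (Z ⟶ Y) → Prop
  precomp : ∀ {Z W : C} (h : W ⟶ Z) (f : Z ⟶ X) (g : Z ⟶ Y), mem f g → mem (h ≫ f) (h ≫ g)
  closed : ∀ {Z : C} (f : Z ⟶ X) (g : Z ⟶ Y) (S : Sieve Z), S ∈ J Z →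
    (∀ {W : C} (s : W ⟶ Z), S s → mem (s ≫ f) (s ≫ g)) → mem f g

namespace ClosedCrible

variable {C : Type u} [Category.{v} C] {J : GrothendieckTopology C} {X Y Z T : C}

/-- The closure of a set of spans that is closed under precomposition. -/
def closure (J : GrothendieckTopology C) (P : ∀ {U : C}, (U ⟶ X) → (U ⟶ Y) → Prop)
    (hP : ∀ {U W : C} (h : W ⟶ U) (f : U ⟶ X) (g : U ⟶ Y), P f g → P (h ≫ f) (h ≫ g)) :
    ClosedCrible J X Y where
  mem {U} f g := ∃ S ∈ J U, ∀ {W : C} (s : W ⟶ U), S s → P (s ≫ f) (s ≫ g)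
  precomp h f g := by
    rintro ⟨S, hS, H⟩
    refine ⟨S.pullback h, J.pullback_stable h hS, fun s hs => ?_⟩
    simpa using H (s ≫ h) hs
  closed {U} f g S hS H := by
    refine ⟨⟨fun W s => P (s ≫ f) (s ≫ g), fun hs t => by
      simpa using hP t _ _ hs⟩, ?_, fun s hs => hs⟩
    refine J.transitive hS _ fun W s hs => ?_
    obtain ⟨S', hS', H'⟩ := H s hs
    refine J.superset_covering (fun W' t ht => ?_) hS'
    simpa using H' t ht

theorem mem_closure_of {P : ∀ {U : C}, (U ⟶ X) → (U ⟶ Y) → Prop}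
    (hP : ∀ {U W : C} (h : W ⟶ U) (f : U ⟶ X) (g : U ⟶ Y), P f g → P (h ≫ f) (h ≫ g))
    {U : C} {f : U ⟶ X} {g : U ⟶ Y} (h : P f g) : (closure J P hP).mem f g :=
  ⟨⊤, J.top_mem U, fun s _ => hP s f g h⟩

theorem mem_of_closure {P : ∀ {U : C}, (U ⟶ X) → (U ⟶ Y) → Prop}
    (hP : ∀ {U W : C} (h : W ⟶ U) (f : U ⟶ X) (g : U ⟶ Y), P f g → P (h ≫ f) (h ≫ g))
    (R : ClosedCrible J X Y) (H : ∀ {U : C} {f : U ⟶ X} {g : U ⟶ Y}, P f g → R.mem f g)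
    {U : C} {f : U ⟶ X} {g : U ⟶ Y} (h : (closure J P hP).mem f g) : R.mem f g := by
  obtain ⟨S, hS, h⟩ := h
  exact R.closed f g S hS fun s hs => H (h s hs)

theorem ext_iff' {R S : ClosedCrible J X Y}
    (h : ∀ {U : C} (f : U ⟶ X) (g : U ⟶ Y), R.mem f g ↔ S.mem f g) : R = S := by
  apply ClosedCrible.ext
  funext U f g
  exact propext (h f g)

/-- Closed cribles are ordered by inclusion. -/
instance : LE (ClosedCrible J X Y) :=
  ⟨fun R S => ∀ ⦃U : C⦄ (f : U ⟶ X) (g : U ⟶ Y), R.mem f g → S.mem f g⟩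

instance : PartialOrder (ClosedCrible J X Y) where
  le_refl _ _ _ _ h := h
  le_trans _ _ _ h h' _ f g k := h' f g (h f g k)
  le_antisymm _ _ h h' := ext_iff' fun f g => ⟨h f g, h' f g⟩

/-- Infima are intersections; suprema are closures of unions. -/
instance : CompleteLattice (ClosedCrible J X Y) where
  sup R S := closure J (fun f g => R.mem f g ∨ S.mem f g) fun h f g k =>
    k.imp (R.precomp h f g) (S.precomp h f g)
  le_sup_left _ _ _ _ _ h := mem_closure_of _ (Or.inl h)
  le_sup_right _ _ _ _ _ h := mem_closure_of _ (Or.inr h)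
  sup_le _ _ T h h' _ _ _ k := mem_of_closure _ T (fun l => l.elim (h _ _) (h' _ _)) k
  inf R S :=
    { mem := fun f g => R.mem f g ∧ S.mem f g
      precomp := fun h f g k => k.imp (R.precomp h f g) (S.precomp h f g)
      closed := fun f g T hT h =>
        ⟨R.closed f g T hT fun s hs => (h s hs).1, S.closed f g T hT fun s hs => (h s hs).2⟩ }
  inf_le_left _ _ _ _ _ h := h.1
  inf_le_right _ _ _ _ _ h := h.2
  le_inf _ _ _ h h' _ f g k := ⟨h f g k, h' f g k⟩
  sSup 𝓢 := closure J (fun f g => ∃ R ∈ 𝓢, R.mem f g) fun h f g ⟨R, hR, k⟩ =>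
    ⟨R, hR, R.precomp h f g k⟩
  isLUB_sSup _ := ⟨fun R hR _ _ _ h => mem_closure_of _ ⟨R, hR, h⟩,
    fun T hT _ _ _ k => mem_of_closure _ T (fun ⟨_, hR, l⟩ => hT hR _ _ l) k⟩
  sInf 𝓢 :=
    { mem := fun f g => ∀ R ∈ 𝓢, R.mem f g
      precomp := fun h f g k R hR => R.precomp h f g (k R hR)
      closed := fun f g T hT h R hR => R.closed f g T hT fun s hs => h s hs R hR }
  isGLB_sInf _ := ⟨fun R hR _ _ _ h => h R hR, fun _ hT _ f g k _ hR => hT hR f g k⟩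
  top := ⟨fun _ _ => True, fun _ _ _ _ => trivial, fun _ _ _ _ _ => trivial⟩
  le_top _ _ _ _ _ := trivial
  bot := closure J (fun _ _ => False) fun _ _ _ h => h
  bot_le R _ _ _ k := mem_of_closure _ R (fun l => l.elim) k

/-- The closure of the set of all spans `(f, f)`. -/
def id (J : GrothendieckTopology C) (X : C) : ClosedCrible J X X :=
  closure J (fun f g => f = g) fun h _ _ k => congrArg (h ≫ ·) k

theorem comp_precomp (R : ClosedCrible J X Y) (S : ClosedCrible J Y Z) {U W : C} (k : W ⟶ U)
    (f : U ⟶ X) (g : U ⟶ Z) : (∃ h : U ⟶ Y, R.mem f h ∧ S.mem h g) →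
      ∃ h : W ⟶ Y, R.mem (k ≫ f) h ∧ S.mem h (k ≫ g) :=
  fun ⟨h, hR, hS⟩ => ⟨k ≫ h, R.precomp k f h hR, S.precomp k h g hS⟩

/-- The closure of the set of all spans `(f, g)` such that `(f, h) ∈ R` and `(h, g) ∈ S` for
some `h`. -/
def comp (R : ClosedCrible J X Y) (S : ClosedCrible J Y Z) : ClosedCrible J X Z :=
  closure J (fun {U} f g => ∃ h : U ⟶ Y, R.mem f h ∧ S.mem h g) (comp_precomp R S)

theorem mem_comp {R : ClosedCrible J X Y} {S : ClosedCrible J Y Z} {U : C} {f : U ⟶ X}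
    (h : U ⟶ Y) {g : U ⟶ Z} (hR : R.mem f h) (hS : S.mem h g) : (R.comp S).mem f g :=
  mem_closure_of (comp_precomp R S) ⟨h, hR, hS⟩

theorem comp_le {R : ClosedCrible J X Y} {S : ClosedCrible J Y Z} {T : ClosedCrible J X Z}
    (H : ∀ {U : C} (f : U ⟶ X) (h : U ⟶ Y) (g : U ⟶ Z), R.mem f h → S.mem h g → T.mem f g) :
    R.comp S ≤ T :=
  fun _ _ _ k => mem_of_closure (comp_precomp R S) T (fun ⟨h, hR, hS⟩ => H _ h _ hR hS) k

theorem id_comp (R : ClosedCrible J X Y) : (id J X).comp R = R := by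
  refine le_antisymm (comp_le fun f h g hf hR => ?_) fun _ f g k => ?_
  · obtain ⟨S, hS, H⟩ := hf
    refine R.closed f g S hS fun s hs => ?_
    rw [H s hs]
    exact R.precomp s h g hR
  · exact mem_comp f (mem_closure_of (fun h _ _ k => congrArg (h ≫ ·) k) rfl) k

theorem comp_id (R : ClosedCrible J X Y) : R.comp (id J Y) = R := by
  refine le_antisymm (comp_le fun f h g hR hg => ?_) fun _ f g k => ?_
  · obtain ⟨S, hS, H⟩ := hg
    refine R.closed f g S hS fun s hs => ?_
    rw [← H s hs]
    exact R.precomp s f h hR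
  · exact mem_comp g k (mem_closure_of (fun h _ _ k => congrArg (h ≫ ·) k) rfl)

theorem comp_assoc (R : ClosedCrible J X Y) (S : ClosedCrible J Y Z) (T : ClosedCrible J Z T) :
    (R.comp S).comp T = R.comp (S.comp T) := by
  refine le_antisymm (comp_le fun f h g hRS hT => ?_) (comp_le fun f h g hR hST => ?_)
  · obtain ⟨V, hV, H⟩ := hRS
    refine (R.comp (S.comp T)).closed f g V hV fun s hs => ?_
    obtain ⟨k, hR, hS⟩ := H s hs
    exact mem_comp k hR (mem_comp (s ≫ h) hS (T.precomp s h g hT))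
  · obtain ⟨V, hV, H⟩ := hST
    refine ((R.comp S).comp T).closed f g V hV fun s hs => ?_
    obtain ⟨k, hS, hT⟩ := H s hs
    exact mem_comp k (mem_comp (s ≫ h) (R.precomp s f h hR) hS) hT

theorem sSup_comp (𝓢 : Set (ClosedCrible J X Y)) (S : ClosedCrible J Y Z) :
    (sSup 𝓢).comp S = ⨆ R ∈ 𝓢, R.comp S := by
  refine le_antisymm (comp_le fun f h g hR hS => ?_) (iSup₂_le fun R hR => comp_le
    fun f h g hf hS => mem_comp h (le_sSup hR f h hf) hS)
  obtain ⟨V, hV, H⟩ := hR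
  refine (⨆ R ∈ 𝓢, R.comp S).closed f g V hV fun s hs => ?_
  obtain ⟨R, hR, k⟩ := H s hs
  exact (le_iSup₂ (f := fun R (_ : R ∈ 𝓢) => R.comp S) R hR) _ _
    (mem_comp (s ≫ h) k (S.precomp s h g hS))

theorem comp_sSup (R : ClosedCrible J X Y) (𝓢 : Set (ClosedCrible J Y Z)) :
    R.comp (sSup 𝓢) = ⨆ S ∈ 𝓢, R.comp S := by
  refine le_antisymm (comp_le fun f h g hR hS => ?_) (iSup₂_le fun S hS => comp_le
    fun f h g hf hg => mem_comp h hf (le_sSup hS h g hg))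
  obtain ⟨V, hV, H⟩ := hS
  refine (⨆ S ∈ 𝓢, R.comp S).closed f g V hV fun s hs => ?_
  obtain ⟨S, hS, k⟩ := H s hs
  exact (le_iSup₂ (f := fun S (_ : S ∈ 𝓢) => R.comp S) S hS) _ _
    (mem_comp (s ≫ h) (R.precomp s f h hR) k)

end ClosedCrible

/-- The objects of the quantaloid `R(C, J)` of closed cribles: those of `C`. -/
structure ClosedCribles {C : Type u} [Category.{u} C] (J : GrothendieckTopology C) where
  obj : C

/-- The quantaloid `R(C, J)` of closed cribles in the site `(C, J)`. -/
instance {C : Type u} [Category.{u} C] (J : GrothendieckTopology C) :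
    Quantaloid.{u} (ClosedCribles J) where
  Hom X Y := ClosedCrible J X.obj Y.obj
  id X := ClosedCrible.id J X.obj
  comp R S := ClosedCrible.comp R S
  id_comp := ClosedCrible.id_comp
  comp_id := ClosedCrible.comp_id
  assoc := ClosedCrible.comp_assoc
  homLattice _ _ := inferInstanceAs (CompleteLattice (ClosedCrible J _ _))
  sSup_comp := ClosedCrible.sSup_comp
  comp_sSup := ClosedCrible.comp_sSup

/-- `Q` is a small quantaloid of closed cribles: it is equivalent to `R(C, J)` for a small
site `(C, J)`. -/
def Quantaloid.IsSmallQuantaloidOfClosedCribles (Q : Type u) [Quantaloid.{u} Q] : Prop :=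
  ∃ (C : Type u) (_ : Category.{u} C) (J : GrothendieckTopology C),
    Quantaloid.Equivalent Q (ClosedCribles J)

/-! Three properties of the quantaloid of closed cribles carry the proof, and all three pass along
equivalences: it is modular for the reversal of spans, its hom-lattices are frames, and each
morphism is the supremum of the composites `f* g` of left adjoints below it. Composites are written
in diagrammatic order.

Modularity forces `f* = f°` for every left adjoint `f`, so generation by left adjoints forces the
involution to be the stated formula (`inv_eq_canonicalInvolute`).

The modular law in `SymDist` holds elementwise, the frame law moving the meet inside the supremum. A
distributor `Φ` is tabulated by the symmetric category of all spans of left adjoints contained in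
its elements, with hom-arrows the meets of those pulled back along the two legs: generation recovers
`Φ`, and the meet condition holds by construction. A symmetric idempotent `e` splits through the
category of all left adjoints `m` with `1 ≤ m e m°`, with hom-arrows `m e n°`. There are enough of
them because `h° k ≤ e` with `h`, `k` left adjoints already gives `1 ≤ k e k°`. -/

namespace Quantaloid

/-! ### Left adjoints in a quantaloid with involution -/

section Adjoints

variable {Q : Type u} [Quantaloid.{v} Q]

theorem IsAdjoint.comp {X Y Z : Q} {f : X ⟶ Y} {f' : Y ⟶ X} {g : Y ⟶ Z} {g' : Z ⟶ Y}
    (hf : IsAdjoint f f') (hg : IsAdjoint g g') : IsAdjoint (f ≫ g) (g' ≫ f') := by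
  constructor
  · calc 𝟙 X ≤ f ≫ 𝟙 Y ≫ f' := by simpa using hf.1
      _ ≤ f ≫ (g ≫ g') ≫ f' := comp_mono le_rfl (comp_mono hg.1 le_rfl)
      _ = _ := by simp
  · calc (g' ≫ f') ≫ f ≫ g = g' ≫ (f' ≫ f) ≫ g := by simp
      _ ≤ g' ≫ 𝟙 Y ≫ g := comp_mono le_rfl (comp_mono hf.2 le_rfl)
      _ ≤ 𝟙 Z := by simpa using hg.2

theorem isAdjoint_of_iso {X Y : Q} (i : X ≅ Y) : IsAdjoint i.hom i.inv :=
  ⟨i.hom_inv_id.ge, i.inv_hom_id.le⟩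

/-- Any two morphisms are equal if they dominate the same composites `f* g`, where `f` and `g` are
left adjoints. -/
def GeneratedByAdjoints (Q : Type u) [Quantaloid.{v} Q] : Prop :=
  ∀ {X Y : Q} (q r : X ⟶ Y), (∀ (U : Q) (f : U ⟶ X) (f' : X ⟶ U) (g : U ⟶ Y) (g' : Y ⟶ U),
    IsAdjoint f f' → IsAdjoint g g' → f' ≫ g ≤ q → f' ≫ g ≤ r) → q ≤ r

/-- The hom-lattices of `Q` are frames. -/
def LocallyLocalic (Q : Type u) [Quantaloid.{v} Q] : Prop :=
  ∀ {X Y : Q} (S : Set (X ⟶ Y)) (h : X ⟶ Y), sSup S ⊓ h ≤ ⨆ f ∈ S, f ⊓ h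

theorem iSup_inf_le_of_locallyLocalic (hL : LocallyLocalic Q) {ι : Sort*} {X Y : Q}
    (f : ι → (X ⟶ Y)) (h : X ⟶ Y) : (⨆ i, f i) ⊓ h ≤ ⨆ i, f i ⊓ h := by
  have := hL (Set.range f) h
  rwa [iSup_range] at this

namespace Involution

variable (I : Involution Q)

theorem inv_le_iff {X Y : Q} {f : X ⟶ Y} {g : Y ⟶ X} : I.inv f ≤ g ↔ f ≤ I.inv g :=
  ⟨fun h => by simpa [I.inv_inv] using I.inv_mono h,
    fun h => by simpa [I.inv_inv] using I.inv_mono h⟩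

theorem inv_inf {X Y : Q} (f g : X ⟶ Y) : I.inv (f ⊓ g) = I.inv f ⊓ I.inv g := by
  refine le_antisymm (le_inf (I.inv_mono inf_le_left) (I.inv_mono inf_le_right)) ?_
  rw [← I.inv_inv (I.inv f ⊓ I.inv g)]
  exact I.inv_mono (le_inf (I.inv_le_iff.2 inf_le_left) (I.inv_le_iff.2 inf_le_right))

variable {I}

/-- In a modular quantaloid, right adjoints are involutes. -/
theorem eq_inv_of_isAdjoint (hM : IsModular I) {X Y : Q} {f : X ⟶ Y} {g : Y ⟶ X}
    (h : IsAdjoint f g) : g = I.inv f := by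
  have key : ∀ {X Y : Q} {f : X ⟶ Y} {g : Y ⟶ X}, IsAdjoint f g → f ≤ I.inv g := by
    intro X Y f g h
    -- The modular law against the identity: the unit survives when `f` is cut down to `f ⊓ g°`. The
    -- counit then gives `f ≤ f ⊓ g°`.
    have h1 : 𝟙 X ≤ (f ⊓ I.inv g) ≫ g := by
      simpa [inf_eq_right.2 h.1] using hM f g (𝟙 X)
    calc f = 𝟙 X ≫ f := by simp
      _ ≤ ((f ⊓ I.inv g) ≫ g) ≫ f := comp_mono h1 le_rfl
      _ = (f ⊓ I.inv g) ≫ g ≫ f := by simp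
      _ ≤ (f ⊓ I.inv g) ≫ 𝟙 Y := comp_mono le_rfl h.2
      _ ≤ I.inv g := by simp
  -- The other inequality is `key` for the adjunction `g° ⊣ f°`, the involute of the given one.
  refine le_antisymm ?_ (I.inv_le_iff.2 (key h))
  have h' : IsAdjoint (I.inv g) (I.inv f) := by
    constructor
    · rw [← I.inv_comp, ← I.inv_id]; exact I.inv_mono h.1
    · rw [← I.inv_comp, ← I.inv_id Y]; exact I.inv_mono h.2
  simpa [I.inv_inv] using I.inv_mono (key h')

theorem isAdjoint_inv (hM : IsModular I) {X Y : Q} {f : X ⟶ Y} (h : IsLeftAdj f) :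
    IsAdjoint f (I.inv f) := by
  obtain ⟨g, hg⟩ := h
  rwa [← eq_inv_of_isAdjoint hM hg]

/-- Since right adjoints are involutes, `g* f ≤ q` is the involute of `f* g ≤ q°`. The canonical
formula is therefore the supremum of all `f* g` below `q°`, which is `q°` by generation. -/
theorem inv_eq_canonicalInvolute (hM : IsModular I) (hG : GeneratedByAdjoints Q) {X Y : Q}
    (q : Y ⟶ X) : I.inv q = canonicalInvolute q := by
  refine le_antisymm (hG _ _ fun U f f' g g' hf hg h => le_sSup
    ⟨U, f, f', g, g', hf, hg, ?_, rfl⟩) (sSup_le ?_)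
  · rw [eq_inv_of_isAdjoint hM hf] at h
    rw [eq_inv_of_isAdjoint hM hg, ← I.inv_inv f, ← I.inv_comp]
    exact I.inv_le_iff.2 h
  · rintro _ ⟨U, f, f', g, g', hf, hg, h, rfl⟩
    rw [eq_inv_of_isAdjoint hM hg] at h
    rw [eq_inv_of_isAdjoint hM hf, ← I.inv_inv g, ← I.inv_comp]
    exact I.inv_mono h

theorem le_of_forall_leftAdj (hM : IsModular I) (hG : GeneratedByAdjoints Q) {X Y : Q}
    {q r : X ⟶ Y} (H : ∀ (U : Q) (f : U ⟶ X) (g : U ⟶ Y), IsLeftAdj f → IsLeftAdj g →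
      I.inv f ≫ g ≤ q → I.inv f ≫ g ≤ r) : q ≤ r :=
  hG q r fun U f f' g g' hf hg h => by
    rw [eq_inv_of_isAdjoint hM hf] at h ⊢
    exact H U f g ⟨f', hf⟩ ⟨g', hg⟩ h

end Involution

end Adjoints

/-! ### Transport along equivalences -/

section Equivalence

variable {Q : Type*} {R : Type*} [Quantaloid Q] [Quantaloid R] {F : Q ⥤ R}

theorem IsHomomorphism.map_sup (hF : IsHomomorphism F) {X Y : Q} (f g : X ⟶ Y) :
    F.map (f ⊔ g) = F.map f ⊔ F.map g := by
  rw [← sSup_pair, hF, iSup_pair]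

variable [F.IsEquivalence]

/-- An equivalence of quantaloids is an isomorphism on hom-lattices. -/
noncomputable def IsHomomorphism.orderIso (hF : IsHomomorphism F) (X Y : Q) :
    (X ⟶ Y) ≃o (F.obj X ⟶ F.obj Y) where
  toEquiv := (Functor.FullyFaithful.ofFullyFaithful F).homEquiv
  map_rel_iff' {f g} := by
    change F.map f ≤ F.map g ↔ f ≤ g
    rw [← sup_eq_right, ← hF.map_sup, F.map_injective.eq_iff, sup_eq_right]

theorem IsHomomorphism.map_le_map (hF : IsHomomorphism F) {X Y : Q} {f g : X ⟶ Y} :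
    F.map f ≤ F.map g ↔ f ≤ g :=
  (hF.orderIso X Y).le_iff_le

theorem IsHomomorphism.map_inf (hF : IsHomomorphism F) {X Y : Q} (f g : X ⟶ Y) :
    F.map (f ⊓ g) = F.map f ⊓ F.map g :=
  (hF.orderIso X Y).map_inf f g

theorem IsHomomorphism.map_iSup (hF : IsHomomorphism F) {ι : Sort*} {X Y : Q}
    (f : ι → (X ⟶ Y)) : F.map (⨆ i, f i) = ⨆ i, F.map (f i) :=
  (hF.orderIso X Y).map_iSup f

theorem IsHomomorphism.isAdjoint_map (hF : IsHomomorphism F) {X Y : Q} {f : X ⟶ Y}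
    {g : Y ⟶ X} : IsAdjoint (F.map f) (F.map g) ↔ IsAdjoint f g := by
  simp only [IsAdjoint, ← F.map_comp, ← F.map_id, hF.map_le_map]

/-- The involution induced along an equivalence. -/
noncomputable def Involution.pullback (I : Involution R) (hF : IsHomomorphism F) :
    Involution Q where
  inv f := F.preimage (I.inv (F.map f))
  inv_inv f := F.map_injective (by simp [I.inv_inv])
  inv_id X := F.map_injective (by simp [I.inv_id])
  inv_comp f g := F.map_injective (by simp [I.inv_comp])
  inv_sSup S := F.map_injective (by simp [hF S, hF.map_iSup, I.inv_iSup])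

theorem Involution.map_pullback (I : Involution R) (hF : IsHomomorphism F) {X Y : Q}
    (f : X ⟶ Y) : F.map ((I.pullback hF).inv f) = I.inv (F.map f) :=
  F.map_preimage _

theorem isModular_pullback {I : Involution R} (hM : IsModular I) (hF : IsHomomorphism F) :
    IsModular (I.pullback hF) := by
  intro X Y Z f g h
  rw [← hF.map_le_map]
  simpa only [hF.map_inf, F.map_comp, I.map_pullback hF] using hM (F.map f) (F.map g) (F.map h)

theorem locallyLocalic_of_equivalence (hL : LocallyLocalic R) (hF : IsHomomorphism F) :
    LocallyLocalic Q := by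
  intro X Y S h
  rw [← hF.map_le_map, hF.map_inf, sSup_eq_iSup']
  simp only [hF.map_iSup, hF.map_inf]
  rw [← iSup_subtype'']
  exact iSup_inf_le_of_locallyLocalic hL _ _

/-- Only the apex of a span in `R` may lie outside the image of `F`. Replacing it by an isomorphic
object in the image leaves `f* g` unchanged, and the adjunctions lift because `F` is full and
reflects the order. -/
theorem generatedByAdjoints_of_equivalence (hG : GeneratedByAdjoints R)
    (hF : IsHomomorphism F) : GeneratedByAdjoints Q := by
  intro X Y q r H
  rw [← hF.map_le_map]
  refine hG _ _ fun V f f' g g' hf hg h => ?_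
  let i := F.objObjPreimageIso V
  have hi := isAdjoint_of_iso i
  have e : f' ≫ g = F.map (F.preimage (f' ≫ i.inv) ≫ F.preimage (i.hom ≫ g)) := by simp
  rw [e, hF.map_le_map] at h ⊢
  refine H _ (F.preimage (i.hom ≫ f)) _ _ (F.preimage (g' ≫ i.inv)) ?_ ?_ h
  · rw [← hF.isAdjoint_map]; simpa using hi.comp hf
  · rw [← hF.isAdjoint_map]; simpa using hi.comp hg

end Equivalence

/-! ### Symmetric categories and distributors -/

section SymDist

variable {Q : Type u} [Quantaloid.{u} Q] {I : Involution Q}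

/-- The frame law distributes the meet over the supremum in `y`; the modular law of `Q` then applies
to each term, and the index `z' = z` suffices on the right. -/
theorem isModular_symDist (hM : IsModular I) (hL : LocallyLocalic Q) :
    IsModular (SymDist.involution I) := by
  intro A B C Φ Ψ Θ x z
  change (⨆ y, Distributor.app Φ x y ≫ Distributor.app Ψ y z) ⊓ Distributor.app Θ x z ≤
    ⨆ y, (Distributor.app Φ x y ⊓ ⨆ z', Distributor.app Θ x z' ≫ I.inv (Distributor.app Ψ y z')) ≫
      Distributor.app Ψ y z
  refine (iSup_inf_le_of_locallyLocalic hL _ _).trans (iSup_mono fun y => (hM _ _ _).trans ?_)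
  exact comp_mono (inf_le_inf_left _ (le_iSup_of_le z le_rfl)) le_rfl

/-- The composite `f a g°`. -/
def conj (I : Involution Q) {X Y U V : Q} (f : U ⟶ X) (a : X ⟶ Y) (g : V ⟶ Y) : U ⟶ V :=
  f ≫ a ≫ I.inv g

theorem inv_conj {X Y U V : Q} (f : U ⟶ X) (a : X ⟶ Y) (g : V ⟶ Y) :
    I.inv (conj I f a g) = conj I g (I.inv a) f := by
  simp [conj, I.inv_comp, I.inv_inv]

/-- The counit `g° g ≤ 1` cancels the middle legs. This gives the composition law for hom-arrows
pulled back along left adjoints. -/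
theorem conj_comp_le (hM : IsModular I) {X Y Z U V W : Q} {f : U ⟶ X} {g : V ⟶ Y} {h : W ⟶ Z}
    {a : X ⟶ Y} {b : Y ⟶ Z} {c : X ⟶ Z} (hg : IsLeftAdj g) (habc : a ≫ b ≤ c) :
    conj I f a g ≫ conj I g b h ≤ conj I f c h :=
  calc conj I f a g ≫ conj I g b h = f ≫ a ≫ (I.inv g ≫ g) ≫ b ≫ I.inv h := by simp [conj]
    _ ≤ f ≫ a ≫ 𝟙 Y ≫ b ≫ I.inv h :=
      comp_mono le_rfl (comp_mono le_rfl (comp_mono (Involution.isAdjoint_inv hM hg).2 le_rfl))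
    _ = f ≫ (a ≫ b) ≫ I.inv h := by simp
    _ ≤ _ := comp_mono le_rfl (comp_mono habc le_rfl)

theorem id_le_conj (hM : IsModular I) {X U : Q} {f : U ⟶ X} (hf : IsLeftAdj f) {a : X ⟶ X}
    (ha : 𝟙 X ≤ a) : 𝟙 U ≤ conj I f a f :=
  calc 𝟙 U ≤ f ≫ 𝟙 X ≫ I.inv f := by simpa using (Involution.isAdjoint_inv hM hf).1
    _ ≤ _ := comp_mono le_rfl (comp_mono ha le_rfl)

theorem conj_comp_comp_le (hM : IsModular I) {X Y Z U V : Q} {f : U ⟶ X} {g : V ⟶ Y}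
    {a : X ⟶ Y} {b : Y ⟶ Z} {c : X ⟶ Z} (hg : IsLeftAdj g) (habc : a ≫ b ≤ c) :
    conj I f a g ≫ g ≫ b ≤ f ≫ c :=
  calc conj I f a g ≫ g ≫ b = f ≫ a ≫ (I.inv g ≫ g) ≫ b := by simp [conj]
    _ ≤ f ≫ a ≫ 𝟙 Y ≫ b :=
      comp_mono le_rfl (comp_mono le_rfl (comp_mono (Involution.isAdjoint_inv hM hg).2 le_rfl))
    _ = f ≫ a ≫ b := by simp
    _ ≤ _ := comp_mono le_rfl habc

/-! ### Tabulation of distributors -/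

/-- The spans of left adjoints contained in a distributor. -/
structure SpanIn (I : Involution Q) {A B : QCat Q} (Φ : Distributor A B) where
  src : A.Obj
  tgt : B.Obj
  apex : Q
  left : apex ⟶ A.type src
  right : apex ⟶ B.type tgt
  left_adj : IsLeftAdj left
  right_adj : IsLeftAdj right
  le : I.inv left ≫ right ≤ Φ.app src tgt

/-- The apex of the tabulation of a distributor. -/
def tabulator (hM : IsModular I) {A B : SymDist I} (Φ : Distributor A.cat B.cat) : SymDist I where
  cat :=
    { Obj := SpanIn I Φ
      type := SpanIn.apex
      hom := fun s t => conj I s.left (A.cat.hom s.src t.src) t.left ⊓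
        conj I s.right (B.cat.hom s.tgt t.tgt) t.right
      hom_comp := fun s t _ => le_inf
        ((comp_mono inf_le_left inf_le_left).trans
          (conj_comp_le hM t.left_adj (A.cat.hom_comp _ _ _)))
        ((comp_mono inf_le_right inf_le_right).trans
          (conj_comp_le hM t.right_adj (B.cat.hom_comp _ _ _)))
      id_le := fun s => le_inf (id_le_conj hM s.left_adj (A.cat.id_le _))
        (id_le_conj hM s.right_adj (B.cat.id_le _)) }
  symm s t := by
    change _ ⊓ _ = I.inv (_ ⊓ _)
    rw [I.inv_inf, inv_conj, inv_conj, ← A.symm, ← B.symm]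

/-- The distributor with elements `B(y, F x) f x` induced by a map `F` on objects and a compatible
family of morphisms `f x` between the types. -/
def graph {A B : QCat Q} (F : A.Obj → B.Obj) (f : ∀ x, A.type x ⟶ B.type (F x))
    (H : ∀ x y z, A.hom x y ≫ f y ≫ B.hom (F y) z ≤ f x ≫ B.hom (F x) z) :
    Distributor A B where
  app x y := f x ≫ B.hom (F x) y
  app_hom x y y' := by
    rw [Category.assoc]
    exact comp_mono le_rfl (B.hom_comp _ _ _)
  hom_app x' x y := H x' x y

/-- By symmetry of `B`, the supremum over `z` is that of `B(F x, z) B(z, F y)`, an element of the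
identity distributor composed with itself. The formula yields both the units of the legs of a
tabulation and its meet condition. -/
theorem graph_comp_involute {A B : SymDist I} (F : A.cat.Obj → B.cat.Obj)
    (f : ∀ x, A.cat.type x ⟶ B.cat.type (F x))
    (H : ∀ x y z, A.cat.hom x y ≫ f y ≫ B.cat.hom (F y) z ≤ f x ≫ B.cat.hom (F x) z)
    (x y : A.cat.Obj) :
    ((graph F f H).comp (Distributor.involute I A.symm B.symm (graph F f H))).app x y =
      conj I (f x) (B.cat.hom (F x) (F y)) (f y) := by
  change (⨆ z, (f x ≫ B.cat.hom (F x) z) ≫ I.inv (f y ≫ B.cat.hom (F y) z)) = _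
  have e : ∀ z, (f x ≫ B.cat.hom (F x) z) ≫ I.inv (f y ≫ B.cat.hom (F y) z) =
      f x ≫ (B.cat.hom (F x) z ≫ B.cat.hom z (F y)) ≫ I.inv (f y) := fun z => by
    rw [I.inv_comp, B.symm (F y) z]; simp
  simp only [e, ← comp_iSup, ← iSup_comp]
  exact congrArg (fun a => f x ≫ a ≫ I.inv (f y))
    (congrArg (fun Θ : Distributor B.cat B.cat => Θ.app (F x) (F y))
      (Distributor.id_comp (Distributor.id B.cat)))

theorem involute_comp_graph_le (hM : IsModular I) {A B : SymDist I}
    (F : A.cat.Obj → B.cat.Obj) (f : ∀ x, A.cat.type x ⟶ B.cat.type (F x))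
    (H : ∀ x y z, A.cat.hom x y ≫ f y ≫ B.cat.hom (F y) z ≤ f x ≫ B.cat.hom (F x) z)
    (hf : ∀ x, IsLeftAdj (f x)) :
    (Distributor.involute I A.symm B.symm (graph F f H)).comp (graph F f H) ≤
      Distributor.id B.cat := by
  intro y z
  refine iSup_le fun x => ?_
  change I.inv (f x ≫ B.cat.hom (F x) y) ≫ f x ≫ B.cat.hom (F x) z ≤ B.cat.hom y z
  rw [I.inv_comp, ← B.symm]
  calc (B.cat.hom y (F x) ≫ I.inv (f x)) ≫ f x ≫ B.cat.hom (F x) z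
      = B.cat.hom y (F x) ≫ (I.inv (f x) ≫ f x) ≫ B.cat.hom (F x) z := by simp
    _ ≤ B.cat.hom y (F x) ≫ 𝟙 _ ≫ B.cat.hom (F x) z :=
      comp_mono le_rfl (comp_mono (Involution.isAdjoint_inv hM (hf x)).2 le_rfl)
    _ ≤ _ := by simpa using B.cat.hom_comp _ _ _

theorem isLeftAdj_graph (hM : IsModular I) {A B : SymDist I}
    (F : A.cat.Obj → B.cat.Obj) (f : ∀ x, A.cat.type x ⟶ B.cat.type (F x))
    (H : ∀ x y z, A.cat.hom x y ≫ f y ≫ B.cat.hom (F y) z ≤ f x ≫ B.cat.hom (F x) z)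
    (hf : ∀ x, IsLeftAdj (f x))
    (h : ∀ x y, A.cat.hom x y ≤ conj I (f x) (B.cat.hom (F x) (F y)) (f y)) :
    IsLeftAdj (X := A) (Y := B) (graph F f H) :=
  ⟨(SymDist.involution I).inv (X := A) (Y := B) (graph F f H),
    fun x y => (h x y).trans (graph_comp_involute F f H x y).ge,
    involute_comp_graph_le hM F f H hf⟩

theorem isTabular_symDist (hM : IsModular I) (hG : GeneratedByAdjoints Q) :
    IsTabular (SymDist.involution I) := by
  intro A B Φ
  let U := tabulator hM Φ
  -- The hom-arrow of `U` lies below each of its two pulled-back factors, so both legs are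
  -- compatible with it.
  have HA : ∀ (s t : U.cat.Obj) z, U.cat.hom s t ≫ SpanIn.left t ≫ A.cat.hom t.src z ≤
      SpanIn.left s ≫ A.cat.hom s.src z := fun s t z =>
    (comp_mono inf_le_left le_rfl).trans
      (conj_comp_comp_le hM t.left_adj (A.cat.hom_comp _ _ _))
  have HB : ∀ (s t : U.cat.Obj) z, U.cat.hom s t ≫ SpanIn.right t ≫ B.cat.hom t.tgt z ≤
      SpanIn.right s ≫ B.cat.hom s.tgt z := fun s t z =>
    (comp_mono inf_le_right le_rfl).trans
      (conj_comp_comp_le hM t.right_adj (B.cat.hom_comp _ _ _))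
  refine ⟨U, graph SpanIn.tgt SpanIn.right HB, graph SpanIn.src SpanIn.left HA,
    isLeftAdj_graph hM _ _ _ SpanIn.right_adj fun _ _ => inf_le_right,
    isLeftAdj_graph hM _ _ _ SpanIn.left_adj fun _ _ => inf_le_left, ?_, ?_⟩
  · refine Distributor.ext (funext fun x => funext fun y => ?_)
    change (⨆ s : SpanIn I Φ, I.inv (s.left ≫ A.cat.hom s.src x) ≫ s.right ≫ B.cat.hom s.tgt y) =
      Distributor.app Φ x y
    refine le_antisymm (iSup_le fun s => ?_) ?_
    · rw [I.inv_comp, ← A.symm]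
      calc (A.cat.hom x s.src ≫ I.inv s.left) ≫ s.right ≫ B.cat.hom s.tgt y
          = A.cat.hom x s.src ≫ (I.inv s.left ≫ s.right) ≫ B.cat.hom s.tgt y := by simp
        _ ≤ A.cat.hom x s.src ≫ Distributor.app Φ s.src s.tgt ≫ B.cat.hom s.tgt y :=
          comp_mono le_rfl (comp_mono s.le le_rfl)
        _ ≤ A.cat.hom x s.src ≫ Distributor.app Φ s.src y :=
          comp_mono le_rfl (Distributor.app_hom Φ _ _ _)
        _ ≤ _ := Distributor.hom_app Φ _ _ _
    -- Every generating span below `Φ x y` is itself an object of `U`, and its term dominates `g° f`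
    -- by the identity laws of `A` and `B`.
    · refine Involution.le_of_forall_leftAdj hM hG fun V g f hg hf h => ?_
      refine le_iSup_of_le (⟨x, y, V, g, f, hg, hf, h⟩ : SpanIn I Φ) (comp_mono ?_ ?_)
      · exact I.inv_mono (by simpa using comp_mono (le_refl g) (A.cat.id_le x))
      · simpa using comp_mono (le_refl f) (B.cat.id_le y)
  · refine Distributor.ext (funext fun s => funext fun t => ?_)
    rw [inf_comm]
    exact congrArg₂ (· ⊓ ·) (graph_comp_involute _ _ HA s t) (graph_comp_involute _ _ HB s t)

/-! ### Splitting of symmetric idempotents -/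

/-- The left adjoints that land in the support of an endodistributor. -/
structure ElementIn (I : Involution Q) {A : QCat Q} (e : Distributor A A) where
  pt : A.Obj
  dom : Q
  map : dom ⟶ A.type pt
  map_adj : IsLeftAdj map
  id_le : 𝟙 dom ≤ conj I map (e.app pt pt) map

theorem Distributor.app_comp_app_le {A : QCat Q} {e : Distributor A A} (he : e.comp e = e)
    (x y z : A.Obj) : e.app x y ≫ e.app y z ≤ e.app x z :=
  calc e.app x y ≫ e.app y z ≤ (e.comp e).app x z :=
        le_iSup (fun y => e.app x y ≫ e.app y z) y
    _ = e.app x z := by rw [he]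

/-- The object through which a symmetric idempotent splits. -/
def splitting (hM : IsModular I) {A : SymDist I} {e : Distributor A.cat A.cat}
    (he : e.comp e = e) (hs : ∀ x y, I.inv (e.app x y) = e.app y x) : SymDist I where
  cat :=
    { Obj := ElementIn I e
      type := ElementIn.dom
      hom := fun s t => conj I s.map (e.app s.pt t.pt) t.map
      hom_comp := fun _ t _ => conj_comp_le hM t.map_adj (Distributor.app_comp_app_le he _ _ _)
      id_le := ElementIn.id_le }
  symm s t := by
    change conj I _ _ _ = I.inv (conj I _ _ _)
    rw [inv_conj, hs]

theorem symmetricIdempotentsSplit_symDist (hM : IsModular I) (hG : GeneratedByAdjoints Q) :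
    SymmetricIdempotentsSplitSymmetrically (SymDist.involution I) := by
  intro A e he hs
  change Distributor A.cat A.cat at e
  replace he : e.comp e = e := he
  replace hs : ∀ x y, I.inv (e.app x y) = e.app y x := fun x y =>
    congrArg (fun Θ : Distributor A.cat A.cat => Θ.app y x) hs
  have hee : ∀ x z, ⨆ y, e.app x y ≫ e.app y z = e.app x z := fun x z =>
    congrArg (fun Θ : Distributor A.cat A.cat => Θ.app x z) he
  let B := splitting hM he hs
  let q : Distributor B.cat A.cat :=
    { app := fun s x => ElementIn.map s ≫ e.app s.pt x
      app_hom := fun s x y => by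
        exact (Category.assoc _ _ _).le.trans (comp_mono le_rfl (e.app_hom _ _ _))
      hom_app := fun s t x =>
        conj_comp_comp_le hM t.map_adj (Distributor.app_comp_app_le he _ _ _) }
  refine ⟨B, (SymDist.involution I).inv (X := B) (Y := A) q, q, ?_, ?_,
    ((SymDist.involution I).inv_inv (X := B) (Y := A) q).symm⟩
  · refine Distributor.ext (funext fun x => funext fun z => ?_)
    change (⨆ s : ElementIn I e, I.inv (s.map ≫ e.app s.pt x) ≫ s.map ≫ e.app s.pt z) = e.app x z
    simp only [I.inv_comp, hs]
    refine le_antisymm (iSup_le fun s => ?_) ?_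
    · calc (e.app x s.pt ≫ I.inv s.map) ≫ s.map ≫ e.app s.pt z
          = e.app x s.pt ≫ (I.inv s.map ≫ s.map) ≫ e.app s.pt z := by simp
        _ ≤ e.app x s.pt ≫ 𝟙 _ ≫ e.app s.pt z :=
          comp_mono le_rfl (comp_mono (Involution.isAdjoint_inv hM s.map_adj).2 le_rfl)
        _ ≤ _ := by simpa using Distributor.app_comp_app_le he _ _ _
    -- Writing `e` as `e e` leaves a second factor `e y z` after the first has been covered by terms
    -- `e m° m`.
    · rw [← hee x z]
      refine iSup_le fun y => ?_
      -- Only elements lying over `y` are needed; `eqToHom` merely transports along `s.pt = y` and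
      -- disappears once that equality is eliminated.
      have key : e.app x y ≤ ⨆ s : {s : ElementIn I e // s.pt = y},
          (e.app x s.1.pt ≫ I.inv s.1.map) ≫ s.1.map ≫ eqToHom (congrArg A.cat.type s.2) := by
        refine Involution.le_of_forall_leftAdj hM hG fun U h k hh hk hle => ?_
        have ah := Involution.isAdjoint_inv hM hh
        have ak := Involution.isAdjoint_inv hM hk
        have hle' : I.inv k ≫ h ≤ e.app y x := by
          have := I.inv_mono hle
          rwa [I.inv_comp, I.inv_inv, hs] at this
        -- Inserting the units of `k`, `h`, `k` produces `k (k° h)(h° k) k°`, whose middle lies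
        -- below `e y x ≫ e x y ≤ e y y`. Hence `k` is an object of the splitting.
        have hid : 𝟙 U ≤ conj I k (e.app y y) k :=
          calc 𝟙 U = 𝟙 U ≫ 𝟙 U ≫ 𝟙 U := by simp
            _ ≤ (k ≫ I.inv k) ≫ (h ≫ I.inv h) ≫ (k ≫ I.inv k) :=
              comp_mono ak.1 (comp_mono ah.1 ak.1)
            _ = k ≫ ((I.inv k ≫ h) ≫ (I.inv h ≫ k)) ≫ I.inv k := by simp
            _ ≤ _ := comp_mono le_rfl (comp_mono
              ((comp_mono hle' hle).trans (Distributor.app_comp_app_le he _ _ _)) le_rfl)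
        refine le_iSup_of_le ⟨⟨y, U, k, hk, hid⟩, rfl⟩ ?_
        calc I.inv h ≫ k = I.inv h ≫ 𝟙 U ≫ k := by simp
          _ ≤ I.inv h ≫ (k ≫ I.inv k) ≫ k := comp_mono le_rfl (comp_mono ak.1 le_rfl)
          _ = (I.inv h ≫ k) ≫ I.inv k ≫ k := by simp
          _ ≤ e.app x y ≫ I.inv k ≫ k := comp_mono hle le_rfl
          _ = _ := by simp
      refine (comp_mono key le_rfl).trans ?_
      rw [iSup_comp]
      refine iSup_le ?_
      rintro ⟨s, rfl⟩
      refine le_iSup_of_le s ?_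
      simp
  -- Symmetry turns each term into `m e e n°`; idempotence collapses the supremum to `m e n°`, the
  -- hom-arrow of `B`.
  · refine Distributor.ext (funext fun s => funext fun t => ?_)
    change (⨆ x, (ElementIn.map s ≫ e.app s.pt x) ≫ I.inv (ElementIn.map t ≫ e.app t.pt x)) =
      conj I s.map (e.app s.pt t.pt) t.map
    have h : ∀ x, (ElementIn.map s ≫ e.app s.pt x) ≫ I.inv (ElementIn.map t ≫ e.app t.pt x) =
        s.map ≫ (e.app s.pt x ≫ e.app x t.pt) ≫ I.inv t.map := fun x => by
      rw [I.inv_comp, hs]; simp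
    simp only [h, ← comp_iSup, ← iSup_comp, hee]
    rfl

end SymDist

end Quantaloid

/-! ### The quantaloid of closed cribles -/

namespace ClosedCrible

section

variable {C : Type u} [Category.{v} C] {J : GrothendieckTopology C} {X Y Z : C}

/-- The opposite of a closed crible. -/
def swap (R : ClosedCrible J X Y) : ClosedCrible J Y X where
  mem f g := R.mem g f
  precomp h f g := R.precomp h g f
  closed f g := R.closed g f

theorem swap_mono {R S : ClosedCrible J X Y} (h : R ≤ S) : R.swap ≤ S.swap :=
  fun _ f g k => h g f k

theorem swap_id_le : (ClosedCrible.id J X).swap ≤ ClosedCrible.id J X :=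
  fun _ _ _ ⟨S, hS, H⟩ => ⟨S, hS, fun s hs => (H s hs).symm⟩

theorem swap_comp_le (R : ClosedCrible J X Y) (S : ClosedCrible J Y Z) :
    (R.comp S).swap ≤ S.swap.comp R.swap :=
  fun _ _ _ ⟨V, hV, H⟩ => ⟨V, hV, fun s hs =>
    let ⟨h, hR, hS⟩ := H s hs
    ⟨h, hS, hR⟩⟩

theorem swap_sSup_le (𝓢 : Set (ClosedCrible J X Y)) : (sSup 𝓢).swap ≤ ⨆ R ∈ 𝓢, R.swap :=
  fun _ f g ⟨V, hV, H⟩ => (⨆ R ∈ 𝓢, R.swap).closed f g V hV fun s hs =>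
    let ⟨R, hR, h⟩ := H s hs
    le_iSup₂ (f := fun (R : ClosedCrible J X Y) (_ : R ∈ 𝓢) => R.swap) R hR _ _ h

/-- On a covering sieve a span of `R S` factors through some `h`; the same `h` puts the left half in
`T S°`, since `T` contains the restricted span. -/
theorem modular (R : ClosedCrible J X Y) (S : ClosedCrible J Y Z) (T : ClosedCrible J X Z) :
    R.comp S ⊓ T ≤ (R ⊓ T.comp S.swap).comp S := by
  rintro U f g ⟨⟨V, hV, H⟩, hT⟩
  refine ⟨V, hV, fun s hs => ?_⟩
  obtain ⟨h, hR, hS⟩ := H s hs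
  exact ⟨h, ⟨hR, mem_comp _ (T.precomp s f g hT) hS⟩, hS⟩

theorem sSup_inf_le (𝓢 : Set (ClosedCrible J X Y)) (T : ClosedCrible J X Y) :
    sSup 𝓢 ⊓ T ≤ ⨆ R ∈ 𝓢, R ⊓ T := by
  rintro U f g ⟨⟨V, hV, H⟩, hT⟩
  refine (⨆ R ∈ 𝓢, R ⊓ T).closed f g V hV fun s hs => ?_
  obtain ⟨R, hR, h⟩ := H s hs
  exact le_iSup₂ (f := fun (R : ClosedCrible J X Y) (_ : R ∈ 𝓢) => R ⊓ T) R hR _ _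
    ⟨h, T.precomp s f g hT⟩

/-- The closed crible generated by the graph of a morphism. -/
def ofHom (J : GrothendieckTopology C) (k : X ⟶ Y) : ClosedCrible J X Y :=
  closure J (fun f g => f ≫ k = g) fun h f g e => by rw [Category.assoc, e]

theorem mem_ofHom {U : C} (k : X ⟶ Y) (f : U ⟶ X) : (ofHom J k).mem f (f ≫ k) :=
  mem_closure_of (fun h f g e => by rw [Category.assoc, e]) rfl

theorem id_le_ofHom_comp_swap (k : X ⟶ Y) :
    ClosedCrible.id J X ≤ (ofHom J k).comp (ofHom J k).swap := fun _ f g hfg => by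
  refine mem_of_closure (fun h _ _ e => congrArg (h ≫ ·) e) _ (fun {_ a b} e => ?_) hfg
  subst e
  exact mem_comp (a ≫ k) (mem_ofHom k a) (mem_ofHom k a)

theorem swap_comp_ofHom_le (k : X ⟶ Y) :
    (ofHom J k).swap.comp (ofHom J k) ≤ ClosedCrible.id J Y := by
  refine comp_le fun f h g hf hg => ?_
  obtain ⟨V, hV, H⟩ := hf
  obtain ⟨W, hW, K⟩ := hg
  exact ⟨V ⊓ W, J.intersection_covering hV hW, fun s hs =>
    (H s hs.1).symm.trans (K s hs.2)⟩

/-- Locally, a span in the composite is the restriction of `(f, g)` along the middle map. With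
`mem_swap_ofHom_comp_ofHom`, this makes the composite the least closed crible containing `(f, g)`.
-/
theorem swap_ofHom_comp_ofHom_le {U : C} {R : ClosedCrible J X Y} {f : U ⟶ X} {g : U ⟶ Y}
    (h : R.mem f g) : (ofHom J f).swap.comp (ofHom J g) ≤ R := by
  refine comp_le fun a k b ha hb => ?_
  obtain ⟨V, hV, H⟩ := ha
  obtain ⟨W, hW, K⟩ := hb
  refine R.closed a b (V ⊓ W) (J.intersection_covering hV hW) fun s hs => ?_
  rw [← H s hs.1, ← K s hs.2]
  exact R.precomp _ f g h

theorem mem_swap_ofHom_comp_ofHom {U : C} (f : U ⟶ X) (g : U ⟶ Y) :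
    ((ofHom J f).swap.comp (ofHom J g)).mem f g := by
  have hf := mem_ofHom (J := J) f (𝟙 U)
  have hg := mem_ofHom (J := J) g (𝟙 U)
  rw [Category.id_comp] at hf hg
  exact mem_comp (𝟙 U) hf hg

end

end ClosedCrible

namespace ClosedCribles

open Quantaloid

variable {C : Type u} [Category.{u} C] (J : GrothendieckTopology C)

/-- The involution on closed cribles that reverses spans. -/
def involution : Involution (ClosedCribles J) where
  inv R := ClosedCrible.swap R
  inv_inv _ := rfl
  -- Swapping twice is definitionally the identity, so for identities and composites one inclusion
  -- yields the other by swapping.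
  inv_id _ := le_antisymm ClosedCrible.swap_id_le (ClosedCrible.swap_mono ClosedCrible.swap_id_le)
  inv_comp R S := le_antisymm (ClosedCrible.swap_comp_le R S)
    (ClosedCrible.swap_mono (ClosedCrible.swap_comp_le (ClosedCrible.swap S)
      (ClosedCrible.swap R)))
  inv_sSup 𝓢 := le_antisymm (ClosedCrible.swap_sSup_le 𝓢)
    (iSup₂_le fun _ h => ClosedCrible.swap_mono (le_sSup h))

theorem isModular : IsModular (involution J) :=
  fun R S T => ClosedCrible.modular R S T

theorem locallyLocalic : LocallyLocalic (ClosedCribles J) :=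
  fun 𝓢 T => ClosedCrible.sSup_inf_le 𝓢 T

/-- Each span in a crible generates a smaller crible of the form `f* g`, with `f` and `g` graphs of
morphisms of the site; testing on these recovers membership span by span. -/
theorem generatedByAdjoints : GeneratedByAdjoints (ClosedCribles J) :=
  fun _ _ H U f g h => H ⟨U⟩ (ClosedCrible.ofHom J f) _ (ClosedCrible.ofHom J g) _
    ⟨ClosedCrible.id_le_ofHom_comp_swap f, ClosedCrible.swap_comp_ofHom_le f⟩
    ⟨ClosedCrible.id_le_ofHom_comp_swap g, ClosedCrible.swap_comp_ofHom_le g⟩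
    (ClosedCrible.swap_ofHom_comp_ofHom_le h) f g (ClosedCrible.mem_swap_ofHom_comp_ofHom f g)

end ClosedCribles

theorem mainTheorem6 (Q : Type u) [Quantaloid.{u} Q]
    (hQ : Quantaloid.IsSmallQuantaloidOfClosedCribles Q) :
    ∃ I : Quantaloid.Involution Q,
      (∀ {X Y : Q} (q : Y ⟶ X), I.inv q = Quantaloid.canonicalInvolute q) ∧
      Quantaloid.IsModular (Quantaloid.SymDist.involution I) ∧
      Quantaloid.IsTabular (Quantaloid.SymDist.involution I) ∧
      Quantaloid.SymmetricIdempotentsSplitSymmetrically (Quantaloid.SymDist.involution I) := by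
  obtain ⟨C, _, J, F, hF, _⟩ := hQ
  have hM : Quantaloid.IsModular ((ClosedCribles.involution J).pullback hF) :=
    Quantaloid.isModular_pullback (ClosedCribles.isModular J) hF
  have hG : Quantaloid.GeneratedByAdjoints Q :=
    Quantaloid.generatedByAdjoints_of_equivalence (ClosedCribles.generatedByAdjoints J) hF
  exact ⟨(ClosedCribles.involution J).pullback hF,
    Quantaloid.Involution.inv_eq_canonicalInvolute hM hG,
    Quantaloid.isModular_symDist hM
      (Quantaloid.locallyLocalic_of_equivalence (ClosedCribles.locallyLocalic J) hF),
    Quantaloid.isTabular_symDist hM hG, Quantaloid.symmetricIdempotentsSplit_symDist hM hG⟩
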